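/- Let $N\ge 1$, let $B^{\rm R}_{jk},B^{\rm I}_{jk}$ ($1\le j,k\le N$) be $2N^2$ independent standard one-dimensional Brownian motions on a filtered probability space $(\Omega,\mathcal F,\{\mathcal F_t\},\mathbb P)$ (adapted to $\{\mathcal F_t\}$ and with joint increments after time $s$ independent of $\mathcal F_s$), and let $M(t)=M(0)+\frac{1}{\sqrt{2N}}\big(B^{\rm R}_{jk}(t)+iB^{\rm I}_{jk}(t)\big)_{j,k}$, where $M(0)$ is a deterministic complex $N\times N$ matrix with $N$ distinct eigenvalues. Let $\Lambda(t)=(\Lambda_j(t))_{j=1}^N$ be a continuous adapted process that at all times $t \ge 0$ enumerates the eigenvalues of $M(t)$ with multiplicity (almost surely). Call $(R,L)$ a choice of eigenvector processes if, almost surely, for all $t\ge0$ and $1\le j,k\le N$, $$M(t)R_j(t)=\Lambda_j(t)R_j(t),\qquad L_j(t)^{\rm t}M(t)=\Lambda_j(t)L_j(t)^{\rm t},\qquad L_j(t)^{\rm t}R_k(t)=\delta_{jk}.$$ For such a choice let $S=(R_1\cdots R_N)$, so that $S^{-1}=(L_1\cdots L_N)^{\rm t}$, let $A=S^\dagger S$,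 $A^{-1}=S^{-1}(S^{-1})^\dagger$, and define the overlap matrix by $\mathcal O_{jk}=A^{-1}_{jk}A_{kj}$. A continuous adapted matrix-valued process $X$ is called a solution of the overlap SDEs for $(R,L)$ if $X(0)$ is the overlap matrix of $(R(0),L(0))$ and, for $1\le j,k\le N$ and with $dW:=S^{-1}\,dM\,S$ (Itô differentials), $$dX_{jk}=\sum_{\ell\ne j}\frac{A^{-1}_{jk}A_{k\ell}\,dW_{\ell j}+A_{kj}A^{-1}_{\ell k}\,dW_{j\ell}}{\Lambda_j-\Lambda_\ell}+\sum_{\ell\ne k}\frac{A^{-1}_{jk}A_{\ell j}\,\overline{dW_{\ell k}}+A_{kj}A^{-1}_{j\ell}\,\overline{dW_{k\ell}}}{\overline{\Lambda_k}-\overline{\Lambda_\ell}}+\frac2N\sum_{\ell\ne j,\;m\ne k}\frac{X_{jk}X_{\ell m}+X_{\ell k}X_{jm}}{(\Lambda_j-\Lambda_\ell)(\overline{\Lambda_k}-\overline{\Lambda_m})}\,dt .$$ Then choices of eigenvector processes exist, and for every choice $(R,L)$ the following hold. (1) (Invariance.) For arbitrary non-vanishing factors $c_j(t)$ (time-dependent,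 possibly random), the family $(c_jR_j,\,L_j/c_j)_{j}$ is again a choice of eigenvector processes, it has the same overlap matrix as $(R,L)$ at every time, and a process $X$ is a solution of the overlap SDEs for $(R,L)$ if and only if it is one for $(c_jR_j,L_j/c_j)_j$. (2) (Non-uniqueness of eigenvectors.) There is another choice $(R',L')$ such that, almost surely, $R'_j(t)\neq R_j(t)$ and $L'_j(t)\ne L_j(t)$ for all $t$ and $j$. (3) (Uniqueness of overlaps.) For every choice $(R',L')$, almost surely the overlap matrices of $(R(t),L(t))$ and of $(R'(t),L'(t))$ agree for all $t\ge0$; and if $X$ is a solution of the overlap SDEs for $(R,L)$ and $X'$ one for $(R',L')$, then almost surely $X(t)=X'(t)$ for all $t\ge 0$. -/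

import Mathlib

open MeasureTheory ProbabilityTheory Filter Topology
open scoped NNReal Matrix

noncomputable section

namespace Overlap

/-! ### Brownian motion -/

/-- A family `B` of mutually independent standard one-dimensional Brownian motions on the
filtered probability space `(Ω, 𝓕, μ)`: every component is a standard Brownian motion, the
components are independent as processes, the family is adapted, and the (vector valued)
increments after time `s` are independent of `𝓕 s`. -/
structure IsBrownianFamily {Ω ι : Type*} [mΩ : MeasurableSpace Ω] (μ : Measure Ω)
    (𝓕 : Filtration ℝ≥0 mΩ) (B : ι → ℝ≥0 → Ω → ℝ) : Prop where
  brownian : ∀ i, IsBrownianReal (B i) μ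
  indep : iIndepFun (fun i ω t => B i t ω) μ
  adapted : ∀ i, StronglyAdapted 𝓕 (B i)
  indep_past : ∀ s t, s ≤ t →
    Indep (MeasurableSpace.comap (fun ω i => B i t ω - B i s ω) inferInstance) (𝓕 s) μ

/-- The non-Hermitian matrix valued Brownian motion
`M_{jk}(t) = M_{jk}(0) + (B^R_{jk}(t) + i B^I_{jk}(t)) / √(2N)` started from `m₀`, where
`B^R_{jk} = B (0, j, k)` and `B^I_{jk} = B (1, j, k)`. -/
def matrixBM {Ω : Type*} {N : ℕ} (m₀ : Matrix (Fin N) (Fin N) ℂ)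
    (B : Fin 2 × Fin N × Fin N → ℝ≥0 → Ω → ℝ) (t : ℝ≥0) (ω : Ω) :
    Matrix (Fin N) (Fin N) ℂ :=
  Matrix.of fun j k =>
    m₀ j k + ((B (0, j, k) t ω : ℂ) + Complex.I * (B (1, j, k) t ω : ℂ))
      / (Real.sqrt (2 * N) : ℂ)

/-! ### Itô integrals -/

/-- `IsPartitionSeq t n π`: for every `r`, `π r 0 ≤ π r 1 ≤ ⋯ ≤ π r (n r)` is a partition of
`[0, t]`, and the mesh of these partitions tends to `0` as `r → ∞`. -/
structure IsPartitionSeq (t : ℝ≥0) (n : ℕ → ℕ) (π : ℕ → ℕ → ℝ≥0) : Prop where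
  mono : ∀ r, Monotone (π r)
  first : ∀ r, π r 0 = 0
  last : ∀ r, π r (n r) = t
  mesh : ∀ ε : ℝ≥0, 0 < ε → ∀ᶠ r in atTop, ∀ i < n r, π r (i + 1) - π r i ≤ ε

/-- `I t = ∫₀ᵗ H(s, dZ(s))` is the Itô integral of the process `H`, whose value at each `(s, ω)`
is an (additive) map from the state space of `Z` to `ℂ`, against the process `Z`.
It is a process with continuous paths which, at each time `t`, is the limit in probability of the
left-endpoint Riemann sums along all sequences of partitions of `[0, t]` with mesh tending to `0`.
For continuous adapted integrands against Brownian motion, which is the only way in which it is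
used here, this limit exists and is the usual Itô integral. -/
structure IsItoIntegral {Ω E : Type*} [MeasurableSpace Ω] [Sub E] (μ : Measure Ω)
    (H : ℝ≥0 → Ω → E → ℂ) (Z : ℝ≥0 → Ω → E) (I : ℝ≥0 → Ω → ℂ) : Prop where
  cont : ∀ᵐ ω ∂μ, Continuous fun t => I t ω
  tendsto : ∀ t n π, IsPartitionSeq t n π →
    TendstoInMeasure μ
      (fun r ω => ∑ i ∈ Finset.range (n r),
        H (π r i) ω (Z (π r (i + 1)) ω - Z (π r i) ω))
      atTop (I t)

/-! ### Eigenvalue and eigenvector processes -/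

/-- `Λ` is an eigenvalue process of `M`: an adapted process with continuous paths which at all
times enumerates the eigenvalues of `M(t)` with their multiplicities. -/
structure IsEigenvalueProcess {Ω : Type*} [mΩ : MeasurableSpace Ω] {N : ℕ} (μ : Measure Ω)
    (𝓕 : Filtration ℝ≥0 mΩ) (M : ℝ≥0 → Ω → Matrix (Fin N) (Fin N) ℂ)
    (Λ : ℝ≥0 → Ω → Fin N → ℂ) : Prop where
  adapted : StronglyAdapted 𝓕 Λ
  cont : ∀ᵐ ω ∂μ, Continuous fun t => Λ t ω
  charpoly : ∀ᵐ ω ∂μ, ∀ t,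
    (M t ω).charpoly = ∏ j, (Polynomial.X - Polynomial.C (Λ t ω j))

/-- `R` and `L` (with `R t ω j` and `L t ω j` the vectors `R_j(t)` and `L_j(t)`) are right and left
eigenvector processes associated with the eigenvalue process `Λ` of `M`, normalized by the
bi-orthogonality relation `(L_j, conj R_k) = L_jᵗ R_k = δ_{jk}`. -/
structure IsEigenvectorProcess {Ω : Type*} [MeasurableSpace Ω] {N : ℕ} (μ : Measure Ω)
    (M : ℝ≥0 → Ω → Matrix (Fin N) (Fin N) ℂ) (Λ : ℝ≥0 → Ω → Fin N → ℂ)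
    (R L : ℝ≥0 → Ω → Fin N → Fin N → ℂ) : Prop where
  right : ∀ᵐ ω ∂μ, ∀ t j, M t ω *ᵥ R t ω j = Λ t ω j • R t ω j
  left : ∀ᵐ ω ∂μ, ∀ t j, L t ω j ᵥ* M t ω = Λ t ω j • L t ω j
  biorth : ∀ᵐ ω ∂μ, ∀ t j k, L t ω j ⬝ᵥ R t ω k = if j = k then 1 else 0

/-- The scale transformation `R_j(t) → c_j(t) R_j(t)`. -/
def scaleR {Ω : Type*} {N : ℕ} (c : ℝ≥0 → Ω → Fin N → ℂ)
    (R : ℝ≥0 → Ω → Fin N → Fin N → ℂ) : ℝ≥0 → Ω → Fin N → Fin N → ℂ :=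
  fun t ω j => c t ω j • R t ω j

/-- The scale transformation `L_j(t) → c_j(t)⁻¹ L_j(t)`. -/
def scaleL {Ω : Type*} {N : ℕ} (c : ℝ≥0 → Ω → Fin N → ℂ)
    (L : ℝ≥0 → Ω → Fin N → Fin N → ℂ) : ℝ≥0 → Ω → Fin N → Fin N → ℂ :=
  fun t ω j => (1 / c t ω j) • L t ω j

/-! ### Overlaps

In this part `r j`, `l j` are the right and the left eigenvectors of a single matrix. -/

/-- The matrix `S` with columns `r 1, …, r N`. -/
def matS {N : ℕ} (r : Fin N → Fin N → ℂ) : Matrix (Fin N) (Fin N) ℂ :=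
  Matrix.of fun j k => r k j

/-- The matrix `S⁻¹` with rows `l 1, …, l N`. -/
def matSinv {N : ℕ} (l : Fin N → Fin N → ℂ) : Matrix (Fin N) (Fin N) ℂ :=
  Matrix.of fun j k => l j k

/-- The bi-orthogonality relation says that `matSinv l` is the inverse of `matS r`. -/
theorem matSinv_eq_inv {N : ℕ} {r l : Fin N → Fin N → ℂ}
    (h : ∀ j k, l j ⬝ᵥ r k = if j = k then 1 else 0) : matSinv l = (matS r)⁻¹ := by
  symm
  apply Matrix.inv_eq_left_inv
  ext j k
  rw [Matrix.one_apply, ← h j k]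
  rfl

/-- `A = S† S`. -/
def matA {N : ℕ} (r : Fin N → Fin N → ℂ) : Matrix (Fin N) (Fin N) ℂ :=
  (matS r)ᴴ * matS r

/-- `A⁻¹ = S⁻¹ (S⁻¹)†`. -/
def matAinv {N : ℕ} (l : Fin N → Fin N → ℂ) : Matrix (Fin N) (Fin N) ℂ :=
  matSinv l * (matSinv l)ᴴ

/-- The eigenvector-overlap matrix
`O_{jk} = A⁻¹_{jk} A_{kj} = (l_j, l_k) (r_j, r_k)`. -/
def overlap {N : ℕ} (r l : Fin N → Fin N → ℂ) : Matrix (Fin N) (Fin N) ℂ :=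
  Matrix.of fun j k => matAinv l j k * matA r k j

/-! ### The stochastic differential equations for the overlaps -/

/-- The increment `dM^O_{jk}` of the martingale part, as a function of the increment `dM`. -/
def martIncr {N : ℕ} (lam : Fin N → ℂ) (r l : Fin N → Fin N → ℂ) (j k : Fin N)
    (dM : Matrix (Fin N) (Fin N) ℂ) : ℂ :=
  (∑ ℓ ∈ Finset.univ.filter (fun ℓ => ℓ ≠ j),
    (matAinv l j k * matA r k ℓ * (matSinv l * dM * matS r) ℓ j
      + matA r k j * matAinv l ℓ k * (matSinv l * dM * matS r) j ℓ)
      / (lam j - lam ℓ))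
  + ∑ ℓ ∈ Finset.univ.filter (fun ℓ => ℓ ≠ k),
    (matAinv l j k * matA r ℓ j * star ((matSinv l * dM * matS r) ℓ k)
      + matA r k j * matAinv l j ℓ * star ((matSinv l * dM * matS r) k ℓ))
      / (star (lam k) - star (lam ℓ))

/-- The drift coefficient at the value `o` of the overlap matrix. -/
def drift {N : ℕ} (lam : Fin N → ℂ) (o : Matrix (Fin N) (Fin N) ℂ) (j k : Fin N) : ℂ :=
  2 / (N : ℂ) *
    ∑ ℓ ∈ Finset.univ.filter (fun ℓ => ℓ ≠ j), ∑ m ∈ Finset.univ.filter (fun m => m ≠ k),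
      (o j k * o ℓ m + o ℓ k * o j m)
        / ((lam j - lam ℓ) * (star (lam k) - star (lam m)))

/-- `X` is a solution of the system of SDEs
`dX_{jk} = dM^O_{jk} + drift_{jk}(Λ, X) dt`, `1 ≤ j, k ≤ N`, whose martingale part is built from the
eigenvector processes `R`, `L`, and which starts from the overlap matrix of `R(0)`, `L(0)`. -/
structure IsOverlapSolution {Ω : Type*} [mΩ : MeasurableSpace Ω] {N : ℕ} (μ : Measure Ω)
    (𝓕 : Filtration ℝ≥0 mΩ) (M : ℝ≥0 → Ω → Matrix (Fin N) (Fin N) ℂ)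
    (Λ : ℝ≥0 → Ω → Fin N → ℂ) (R L : ℝ≥0 → Ω → Fin N → Fin N → ℂ)
    (X : ℝ≥0 → Ω → Matrix (Fin N) (Fin N) ℂ) : Prop where
  adapted : StronglyAdapted 𝓕 X
  cont : ∀ᵐ ω ∂μ, Continuous fun t => X t ω
  initial : ∀ᵐ ω ∂μ, X 0 ω = overlap (R 0 ω) (L 0 ω)
  integrable : ∀ j k, ∀ᵐ ω ∂μ, ∀ t : ℝ≥0,
    IntervalIntegrable (fun s : ℝ => drift (Λ s.toNNReal ω) (X s.toNNReal ω) j k) volume 0 t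
  sde : ∀ j k, ∃ I : ℝ≥0 → Ω → ℂ,
    IsItoIntegral μ (fun t ω => martIncr (Λ t ω) (R t ω) (L t ω) j k) M I ∧
    ∀ᵐ ω ∂μ, ∀ t : ℝ≥0, X t ω j k = X 0 ω j k + I t ω
      + ∫ s in (0 : ℝ)..t, drift (Λ s.toNNReal ω) (X s.toNNReal ω) j k

end Overlap

end

/-!
The theorem is a statement about simplicity of the spectrum: once `M(t)` almost surely has `N`
distinct eigenvalues at all times, everything else is linear algebra and Grönwall's inequality.

**No collisions.** The discriminant of the characteristic polynomial of `M` is a polynomial in the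
entries of `M`, hence an entire function `F`, and `F(M(0)) ≠ 0`. The increments of the entries are
rotation invariant: `exp (iθ) W` has the law of `W`. By Jensen's formula `log⁺ ‖F / ε‖` has the
sub-mean value property on complex circles, so that `log⁺ ‖F(M(t)) / ε‖` is a submartingale.
Stopping it when it vanishes, along a finite grid of times, gives
`log (1/ε) · P(‖F(M)‖ ≤ ε at some grid time ≤ T) ≤ E log⁺ ‖F(M(T))‖ - log ‖F(M(0))‖`,
uniformly in the grid. Refining the grid and letting `ε → 0` shows that `F(M(t))` never vanishes
(`HasRotationInvariantIncrements.ae_forall_ne_zero`,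
`Overlap.IsBrownianFamily.ae_forall_nodup_roots`). No stochastic calculus is needed.

**Scale transformations.** For a matrix with simple spectrum bi-orthogonal systems of eigenvectors
exist, and any two differ by a scale transformation `r_j → c_j r_j`, `l_j → l_j / c_j`
(`Overlap.exists_biorthogonal_eigenvectors`, `Overlap.exists_scale_of_biorthogonal`). The overlaps
and the coefficients of the martingale part are unchanged by it (`Overlap.overlap_scale`,
`Overlap.martIncr_scale`).

**Uniqueness of solutions.** Two solutions, for any two choices of eigenvectors, therefore have the
same initial value and the same Itô integral, limits in probability being unique
(`Overlap.IsItoIntegral.ae_forall_eq`). Their difference is pathwise the integral of a difference of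
drifts. As the eigenvalues are continuous and distinct, the drift is locally Lipschitz in the
overlaps, uniformly on compact time intervals, and Grönwall's inequality applies
(`Overlap.eq_of_sub_eq_integral_drift`).
-/

open scoped ENNReal

/-! ### Subharmonicity of `log⁺ ‖f‖` -/

/-- The sub-mean value property of `log⁺ ‖f‖`: if `1 < ‖f 0‖`, then Jensen's formula gives it for
`log ‖f‖`, since the zeros of `f` in the unit disc contribute nonnegative terms. -/
theorem posLog_norm_le_circleAverage {f : ℂ → ℂ} (hf : Differentiable ℂ f) :
    Real.posLog ‖f 0‖ ≤ Real.circleAverage (fun z => Real.posLog ‖f z‖) 0 1 := by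
  have hnonneg : 0 ≤ Real.circleAverage (fun z => Real.posLog ‖f z‖) 0 1 :=
    Real.circleAverage_nonneg_of_nonneg fun _ _ => Real.posLog_nonneg
  rcases le_or_gt ‖f 0‖ 1 with h | h
  · rwa [(Real.posLog_eq_zero_iff _).2 (by simpa using h)]
  · have han : AnalyticOnNhd ℂ f (Metric.closedBall 0 |1|) := fun z _ => hf.analyticAt z
    have h0 : f 0 ≠ 0 := fun h0 => by simp [h0] at h; linarith
    have hjen := han.circleAverage_log_norm one_ne_zero h0
    have hsum : 0 ≤ ∑ᶠ u, (MeromorphicOn.divisor f (Metric.closedBall 0 |1|) u : ℝ)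
        * Real.log (1 * ‖0 - u‖⁻¹) := by
      refine finsum_nonneg fun u => ?_
      by_cases hu : u ∈ Metric.closedBall (0 : ℂ) |1|
      · refine mul_nonneg ?_ ?_
        · exact_mod_cast MeromorphicOn.AnalyticOnNhd.divisor_nonneg han u
        · have hu' : ‖u‖ ≤ 1 := by simpa using hu
          rcases eq_or_ne u 0 with rfl | hne
          · simp
          · rw [one_mul, zero_sub, norm_neg]
            exact Real.log_nonneg ((one_le_inv₀ (norm_pos_iff.2 hne)).2 hu')
      · rw [Function.locallyFinsuppWithin.apply_eq_zero_of_notMem _ hu]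
        simp
    calc Real.posLog ‖f 0‖ = Real.log ‖f 0‖ := Real.posLog_eq_log (by simpa using h.le)
      _ ≤ Real.circleAverage (Real.log ‖f ·‖) 0 1 := by rw [hjen]; linarith
      _ ≤ _ := by
        refine Real.circleAverage_mono ?_ ?_ fun z _ => ?_
        · exact MeromorphicOn.circleIntegrable_log_norm
            (AnalyticOnNhd.meromorphicOn fun z _ => hf.analyticAt z)
        · exact ContinuousOn.circleIntegrable' (by have := hf.continuous; fun_prop)
        · exact le_max_right _ _

/-- The function `log⁺ ‖x‖` with values in `[0, ∞]`, so that it may be integrated without any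
integrability hypothesis. -/
noncomputable def elogNorm (x : ℂ) : ℝ≥0∞ := ENNReal.ofReal (Real.posLog ‖x‖)

@[fun_prop]
theorem continuous_elogNorm : Continuous elogNorm :=
  ENNReal.continuous_ofReal.comp (Real.continuous_posLog.comp continuous_norm)

theorem elogNorm_le_lintegral_circle {f : ℂ → ℂ} (hf : Differentiable ℂ f) :
    ENNReal.ofReal (2 * Real.pi) * elogNorm (f 0) ≤
      ∫⁻ θ in Set.Ioc (0 : ℝ) (2 * Real.pi), elogNorm (f (circleMap 0 1 θ)) := by
  have hpi := Real.two_pi_pos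
  have hc := hf.continuous
  have hcont : Continuous fun θ : ℝ => Real.posLog ‖f (circleMap 0 1 θ)‖ := by fun_prop
  have hle := posLog_norm_le_circleAverage hf
  rw [Real.circleAverage_def, intervalIntegral.integral_of_le hpi.le, smul_eq_mul,
    ← div_eq_inv_mul, le_div_iff₀' hpi] at hle
  unfold elogNorm
  rw [← ofReal_integral_eq_lintegral_ofReal, ← ENNReal.ofReal_mul hpi.le]
  · exact ENNReal.ofReal_le_ofReal hle
  · exact (hcont.intervalIntegrable 0 (2 * Real.pi)).1
  · exact ae_of_all _ fun _ => Real.posLog_nonneg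

/-! ### Rotation invariant measures -/

/-- A measure on a complex vector space is rotation invariant if it is preserved by the
multiplication by every complex number `exp (iθ)`. -/
def IsRotationInvariant {E : Type*} [AddCommGroup E] [Module ℂ E] [MeasurableSpace E]
    (ν : Measure E) : Prop :=
  ∀ θ : ℝ, ν.map (fun w => circleMap 0 1 θ • w) = ν

section RotationInvariant

variable {E : Type*} [NormedAddCommGroup E] [NormedSpace ℂ E] [MeasurableSpace E] [BorelSpace E]
  [SecondCountableTopology E]

/-- For each fixed `w` the function `ζ ↦ F (z + ζ w)` is entire, and averaging its sub-mean value
property over `w` suffices because `exp (iθ) w` and `w` have the same law. -/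
theorem IsRotationInvariant.elogNorm_le {ν : Measure E} [IsProbabilityMeasure ν]
    (hν : IsRotationInvariant ν) {F : E → ℂ} (hF : Differentiable ℂ F) (z : E) :
    elogNorm (F z) ≤ ∫⁻ w, elogNorm (F (z + w)) ∂ν := by
  have hc := hF.continuous
  have hpi : ENNReal.ofReal (2 * Real.pi) ≠ 0 := by simp [Real.pi_pos]
  rw [← ENNReal.mul_le_mul_iff_right hpi ENNReal.ofReal_ne_top]
  calc ENNReal.ofReal (2 * Real.pi) * elogNorm (F z)
      = ∫⁻ _, ENNReal.ofReal (2 * Real.pi) * elogNorm (F z) ∂ν := by simp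
    _ ≤ ∫⁻ w, (∫⁻ θ in Set.Ioc (0 : ℝ) (2 * Real.pi),
          elogNorm (F (z + circleMap 0 1 θ • w))) ∂ν := by
        refine lintegral_mono fun w => ?_
        have := elogNorm_le_lintegral_circle (f := fun ζ : ℂ => F (z + ζ • w)) (by fun_prop)
        simpa using this
    _ = ∫⁻ θ in Set.Ioc (0 : ℝ) (2 * Real.pi), (∫⁻ w, elogNorm (F (z + circleMap 0 1 θ • w)) ∂ν) :=
        lintegral_lintegral_swap (f := fun w θ => elogNorm (F (z + circleMap 0 1 θ • w)))
          (Continuous.aemeasurable (by unfold Function.uncurry; fun_prop))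
    _ = ∫⁻ _ in Set.Ioc (0 : ℝ) (2 * Real.pi), (∫⁻ w, elogNorm (F (z + w)) ∂ν) := by
        refine lintegral_congr fun θ => ?_
        conv_rhs => rw [← hν θ]
        rw [lintegral_map]
        · exact Continuous.measurable (by fun_prop)
        · exact Continuous.measurable (by fun_prop)
    _ = _ := by simp [mul_comm]

/-- If `W` is independent of `(a, Z)` and has a rotation invariant law, then adding `W` to `Z`
does not decrease the expectation of `a · log⁺ ‖F Z‖`. -/
theorem lintegral_mul_elogNorm_le_of_indepFun {Ω : Type*} [MeasurableSpace Ω] {μ : Measure Ω}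
    [IsProbabilityMeasure μ] {a : Ω → ℝ≥0∞} {Z W : Ω → E} (ha : Measurable a)
    (hZ : Measurable Z) (hW : Measurable W) (hind : IndepFun (fun ω => (a ω, Z ω)) W μ)
    (hrot : IsRotationInvariant (μ.map W)) {F : E → ℂ} (hF : Differentiable ℂ F) :
    ∫⁻ ω, a ω * elogNorm (F (Z ω)) ∂μ ≤ ∫⁻ ω, a ω * elogNorm (F (Z ω + W ω)) ∂μ := by
  have hc := hF.continuous
  have : IsProbabilityMeasure (μ.map W) := Measure.isProbabilityMeasure_map hW.aemeasurable
  have hU : Measurable fun z : E => elogNorm (F z) := Continuous.measurable (by fun_prop)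
  have hpair : Measurable fun ω => (a ω, Z ω) := ha.prodMk hZ
  have hG : Measurable fun p : (ℝ≥0∞ × E) × E => p.1.1 * elogNorm (F (p.1.2 + p.2)) :=
    (measurable_fst.comp measurable_fst).mul
      (hU.comp ((measurable_snd.comp measurable_fst).add measurable_snd))
  have hG₀ : Measurable fun p : ℝ≥0∞ × E => p.1 * elogNorm (F p.2) :=
    measurable_fst.mul (hU.comp measurable_snd)
  calc ∫⁻ ω, a ω * elogNorm (F (Z ω)) ∂μ
      = ∫⁻ p, p.1 * elogNorm (F p.2) ∂(μ.map fun ω => (a ω, Z ω)) :=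
        (lintegral_map hG₀ hpair).symm
    _ ≤ ∫⁻ p, ∫⁻ w, p.1 * elogNorm (F (p.2 + w)) ∂(μ.map W) ∂(μ.map fun ω => (a ω, Z ω)) := by
        refine lintegral_mono fun p => ?_
        have hp : Measurable fun w => elogNorm (F (p.2 + w)) := hU.comp (measurable_const_add p.2)
        rw [lintegral_const_mul _ hp]
        gcongr
        exact hrot.elogNorm_le hF p.2
    _ = ∫⁻ q, q.1.1 * elogNorm (F (q.1.2 + q.2))
          ∂((μ.map fun ω => (a ω, Z ω)).prod (μ.map W)) :=
        (lintegral_prod _ hG.aemeasurable).symm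
    _ = _ := by
        rw [← hind.map_prod_eq_prod_map_map hpair.aemeasurable hW.aemeasurable,
          lintegral_map hG (hpair.prodMk hW)]

end RotationInvariant

/-! ### Entire functions along processes with rotation invariant increments -/

theorem elogNorm_mul_le (x y : ℂ) : elogNorm (x * y) ≤ elogNorm x + elogNorm y := by
  unfold elogNorm
  rw [← ENNReal.ofReal_add Real.posLog_nonneg Real.posLog_nonneg, norm_mul]
  exact ENNReal.ofReal_le_ofReal Real.posLog_mul

theorem elogNorm_eq_zero {x : ℂ} (hx : ‖x‖ ≤ 1) : elogNorm x = 0 := by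
  rw [elogNorm, (Real.posLog_eq_zero_iff _).2 (by simpa using hx), ENNReal.ofReal_zero]

theorem elogNorm_of_one_le {x : ℂ} (hx : 1 ≤ ‖x‖) : elogNorm x = ENNReal.ofReal (Real.log ‖x‖) := by
  rw [elogNorm, Real.posLog_eq_log (by simpa using hx)]

/-- The process `Z` is adapted, starts at `z₀`, has continuous paths, and its increments after time
`s` have a rotation invariant law and are independent of `𝓕 s`. -/
structure HasRotationInvariantIncrements {Ω E : Type*} [mΩ : MeasurableSpace Ω]
    [NormedAddCommGroup E] [NormedSpace ℂ E] [MeasurableSpace E] (μ : Measure Ω)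
    (𝓕 : Filtration ℝ≥0 mΩ) (z₀ : E) (Z : ℝ≥0 → Ω → E) : Prop where
  initial : ∀ᵐ ω ∂μ, Z 0 ω = z₀
  cont : ∀ᵐ ω ∂μ, Continuous fun t => Z t ω
  measurable : ∀ t, Measurable[𝓕 t] (Z t)
  indep : ∀ s t, s ≤ t →
    Indep (MeasurableSpace.comap (fun ω => Z t ω - Z s ω) inferInstance) (𝓕 s) μ
  rotation : ∀ s t, s ≤ t → IsRotationInvariant (μ.map fun ω => Z t ω - Z s ω)

namespace HasRotationInvariantIncrements

variable {Ω E : Type*} [mΩ : MeasurableSpace Ω] [NormedAddCommGroup E] [NormedSpace ℂ E]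
  [MeasurableSpace E] [BorelSpace E] [SecondCountableTopology E] {μ : Measure Ω}
  [IsProbabilityMeasure μ] {𝓕 : Filtration ℝ≥0 mΩ} {z₀ : E} {Z : ℝ≥0 → Ω → E} {F : E → ℂ}

/-- The process `log⁺ ‖F Z‖` is a submartingale. -/
theorem setLIntegral_elogNorm_le (hZ : HasRotationInvariantIncrements μ 𝓕 z₀ Z)
    (hF : Differentiable ℂ F) {s t : ℝ≥0} (hst : s ≤ t) {A : Set Ω} (hA : MeasurableSet[𝓕 s] A) :
    ∫⁻ ω in A, elogNorm (F (Z s ω)) ∂μ ≤ ∫⁻ ω in A, elogNorm (F (Z t ω)) ∂μ := by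
  have hm : ∀ t, Measurable (Z t) := fun t => (hZ.measurable t).mono (𝓕.le t) le_rfl
  have hA' : MeasurableSet A := 𝓕.le s _ hA
  have hpair : Measurable[𝓕 s] fun ω => (A.indicator (fun _ => (1 : ℝ≥0∞)) ω, Z s ω) :=
    Measurable.prodMk (Measurable.indicator measurable_const hA) (hZ.measurable s)
  have hind : IndepFun (fun ω => (A.indicator (fun _ => (1 : ℝ≥0∞)) ω, Z s ω))
      (fun ω => Z t ω - Z s ω) μ := by
    rw [IndepFun_iff_Indep]
    exact indep_of_indep_of_le_left (hZ.indep s t hst).symm hpair.comap_le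
  have key := lintegral_mul_elogNorm_le_of_indepFun (measurable_const.indicator hA') (hm s)
    ((hm t).sub (hm s)) hind (hZ.rotation s t hst) hF
  rw [← lintegral_indicator hA', ← lintegral_indicator hA']
  convert key using 1 <;>
  · refine lintegral_congr fun ω => ?_
    by_cases h : ω ∈ A <;> simp [h]

variable (F Z) in
/-- The event that `‖F Z‖ > ε` at the times `τ 0, …, τ n`. -/
def avoids (τ : ℕ → ℝ≥0) (ε : ℝ) (n : ℕ) : Set Ω :=
  {ω | ∀ k ≤ n, ε < ‖F (Z (τ k) ω)‖}

omit [SecondCountableTopology E] [IsProbabilityMeasure μ] in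
theorem measurableSet_avoids (hZ : HasRotationInvariantIncrements μ 𝓕 z₀ Z)
    (hF : Differentiable ℂ F) {τ : ℕ → ℝ≥0} (hτ : Monotone τ) (ε : ℝ) (n : ℕ) :
    MeasurableSet[𝓕 (τ n)] (avoids Z F τ ε n) := by
  have : avoids Z F τ ε n = ⋂ k ∈ Set.Iic n, {ω | ε < ‖F (Z (τ k) ω)‖} := by
    ext ω; simp [avoids]
  rw [this]
  refine MeasurableSet.biInter (Set.to_countable _) fun k hk => ?_
  have h1 : Measurable[𝓕 (τ n)] (Z (τ k)) := (hZ.measurable _).mono (𝓕.mono (hτ hk)) le_rfl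
  exact measurableSet_lt measurable_const (hF.continuous.norm.measurable.comp h1)

/-- Stopping the submartingale `log⁺ ‖F Z / ε‖` when it vanishes. -/
theorem elogNorm_le_setLIntegral_avoids (hZ : HasRotationInvariantIncrements μ 𝓕 z₀ Z)
    (hF : Differentiable ℂ F) {τ : ℕ → ℝ≥0} (hτ : Monotone τ) (hτ₀ : τ 0 = 0) {ε : ℝ}
    (hε : 0 < ε) (hεF : ε < ‖F z₀‖) (n : ℕ) :
    elogNorm ((ε⁻¹ : ℝ) * F z₀) ≤
      ∫⁻ ω in avoids Z F τ ε n, elogNorm ((ε⁻¹ : ℝ) * F (Z (τ n) ω)) ∂μ := by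
  induction n with
  | zero =>
    have h1 : avoids Z F τ ε 0 =ᵐ[μ] Set.univ := by
      rw [eventuallyEq_univ]
      filter_upwards [hZ.initial] with ω hω k hk
      rwa [Nat.le_zero.1 hk, hτ₀, hω]
    rw [setLIntegral_congr h1, setLIntegral_univ,
      lintegral_congr_ae (g := fun _ => elogNorm ((ε⁻¹ : ℝ) * F z₀))]
    · simp
    · filter_upwards [hZ.initial] with ω hω
      rw [hτ₀, hω]
  | succ n ih =>
    have hsub : avoids Z F τ ε (n + 1) ⊆ avoids Z F τ ε n := fun ω h k hk => h k (by omega)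
    have hmeas : ∀ n, MeasurableSet (avoids Z F τ ε n) := fun n =>
      𝓕.le _ _ (hZ.measurableSet_avoids hF hτ ε n)
    -- on the part of the event that is lost at time `n + 1` the integrand vanishes at that time
    refine ih.trans ((hZ.setLIntegral_elogNorm_le (F := fun z => (ε⁻¹ : ℝ) * F z) (by fun_prop)
      (hτ n.le_succ) (hZ.measurableSet_avoids hF hτ ε n)).trans (le_of_eq ?_))
    rw [← lintegral_indicator (hmeas _), ← lintegral_indicator (hmeas _)]
    refine lintegral_congr fun ω => ?_
    by_cases h1 : ω ∈ avoids Z F τ ε (n + 1)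
    · rw [Set.indicator_of_mem h1, Set.indicator_of_mem (hsub h1)]
    · rw [Set.indicator_of_notMem h1]
      by_cases h2 : ω ∈ avoids Z F τ ε n
      · rw [Set.indicator_of_mem h2]
        refine elogNorm_eq_zero ?_
        have h3 : ‖F (Z (τ (n + 1)) ω)‖ ≤ ε := by
          by_contra! h3
          refine h1 fun k hk => ?_
          rcases Nat.lt_or_ge n k with h | h
          · rwa [show k = n + 1 by omega]
          · exact h2 k h
        rw [norm_mul, Complex.norm_real, Real.norm_of_nonneg (by positivity)]
        rwa [inv_mul_le_iff₀ hε, mul_one]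
      · rw [Set.indicator_of_notMem h2]

/-- The probability that `‖F Z‖` gets below `ε` on a grid is of order `1 / log (1/ε)`, with a
constant that depends on the grid only through its last point. -/
theorem log_mul_measureReal_avoids_compl_le (hZ : HasRotationInvariantIncrements μ 𝓕 z₀ Z)
    (hF : Differentiable ℂ F) {τ : ℕ → ℝ≥0} (hτ : Monotone τ) (hτ₀ : τ 0 = 0) {ε : ℝ}
    (hε : 0 < ε) (hε₁ : ε ≤ 1) (hεF : ε < ‖F z₀‖) (n : ℕ)
    (hfin : ∫⁻ ω, elogNorm (F (Z (τ n) ω)) ∂μ ≠ ⊤) :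
    Real.log ε⁻¹ * μ.real (avoids Z F τ ε n)ᶜ ≤
      (∫⁻ ω, elogNorm (F (Z (τ n) ω)) ∂μ).toReal - Real.log ‖F z₀‖ := by
  set G := avoids Z F τ ε n
  have hG : MeasurableSet G := 𝓕.le _ _ (hZ.measurableSet_avoids hF hτ ε n)
  have hlog : 0 ≤ Real.log ε⁻¹ := Real.log_nonneg ((one_le_inv₀ hε).2 hε₁)
  have hinv : ‖((ε⁻¹ : ℝ) : ℂ)‖ = ε⁻¹ := by
    rw [Complex.norm_real, Real.norm_of_nonneg (by positivity)]
  have h1 : ENNReal.ofReal (Real.log (ε⁻¹ * ‖F z₀‖)) ≤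
      ENNReal.ofReal (Real.log ε⁻¹) * μ G + ∫⁻ ω, elogNorm (F (Z (τ n) ω)) ∂μ := by
    calc ENNReal.ofReal (Real.log (ε⁻¹ * ‖F z₀‖)) = elogNorm ((ε⁻¹ : ℝ) * F z₀) := by
          rw [elogNorm_of_one_le, norm_mul, hinv]
          rw [norm_mul, hinv, ← div_eq_inv_mul, one_le_div hε]
          exact hεF.le
      _ ≤ _ := hZ.elogNorm_le_setLIntegral_avoids hF hτ hτ₀ hε hεF n
      _ ≤ ∫⁻ ω in G, (ENNReal.ofReal (Real.log ε⁻¹) + elogNorm (F (Z (τ n) ω))) ∂μ := by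
          refine lintegral_mono fun ω => (elogNorm_mul_le _ _).trans ?_
          rw [elogNorm_of_one_le (x := ((ε⁻¹ : ℝ) : ℂ)), hinv]
          rw [hinv]
          exact (one_le_inv₀ hε).2 hε₁
      _ = ENNReal.ofReal (Real.log ε⁻¹) * μ G + ∫⁻ ω in G, elogNorm (F (Z (τ n) ω)) ∂μ := by
          rw [lintegral_add_left measurable_const, setLIntegral_const]
      _ ≤ _ := by gcongr; exact Measure.restrict_le_self
  have h2 := ENNReal.toReal_mono (by finiteness) h1
  rw [ENNReal.toReal_add (by finiteness) hfin, ENNReal.toReal_mul, ENNReal.toReal_ofReal hlog,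
    ENNReal.toReal_ofReal', Real.log_mul (by positivity) (hε.trans hεF).ne'] at h2
  have h3 : μ.real Gᶜ = 1 - (μ G).toReal := by rw [probReal_compl_eq_one_sub hG]; rfl
  rw [h3]
  have := (le_max_left _ _).trans h2
  linarith

/-- An entire function which does not vanish at the starting point of a process with rotation
invariant increments almost surely does not vanish along the whole path. -/
theorem ae_forall_ne_zero (hZ : HasRotationInvariantIncrements μ 𝓕 z₀ Z)
    (hF : Differentiable ℂ F) (hF₀ : F z₀ ≠ 0)
    (hfin : ∀ t, ∫⁻ ω, elogNorm (F (Z t ω)) ∂μ ≠ ⊤) :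
    ∀ᵐ ω ∂μ, ∀ t, F (Z t ω) ≠ 0 := by
  have hmain : ∀ T : ℕ, ∀ᵐ ω ∂μ, (Continuous fun t => Z t ω) →
      ∀ t : ℝ≥0, t ≤ T → F (Z t ω) ≠ 0 := by
    intro T
    set K := (∫⁻ ω, elogNorm (F (Z T ω)) ∂μ).toReal - Real.log ‖F z₀‖
    -- the grid of mesh `1 / (n + 1)`, which reaches `T` after `T * (n + 1)` steps
    set τ : ℕ → ℕ → ℝ≥0 := fun n k => k / (n + 1)
    have hτ : ∀ n, Monotone (τ n) := fun n k l hkl => by simp only [τ]; gcongr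
    have hτ₀ : ∀ n, τ n 0 = 0 := fun n => by simp [τ]
    have hτT : ∀ n, τ n (T * (n + 1)) = T := fun n => by
      simp only [τ]; push_cast; field_simp
    have hbound : ∀ ε : ℝ, 0 < ε → ε ≤ 1 → ε < ‖F z₀‖ →
        μ {ω | ¬ ((Continuous fun t => Z t ω) → ∀ t : ℝ≥0, t ≤ T → F (Z t ω) ≠ 0)} *
          ENNReal.ofReal (Real.log ε⁻¹) ≤ ENNReal.ofReal K := by
      intro ε hε hε₁ hεF
      set H : ℕ → Set Ω := fun n => (avoids Z F (τ n) ε (T * (n + 1)))ᶜ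
      have hH : ∀ n, μ (H n) * ENNReal.ofReal (Real.log ε⁻¹) ≤ ENNReal.ofReal K := fun n => by
        have := hZ.log_mul_measureReal_avoids_compl_le hF (hτ n) (hτ₀ n) hε hε₁ hεF
          (T * (n + 1)) (hfin _)
        rw [hτT] at this
        rw [← ofReal_measureReal, ← ENNReal.ofReal_mul measureReal_nonneg, mul_comm]
        exact ENNReal.ofReal_le_ofReal this
      have hsub : {ω | ¬ ((Continuous fun t => Z t ω) → ∀ t : ℝ≥0, t ≤ T → F (Z t ω) ≠ 0)} ⊆
          ⋃ m, ⋂ n ∈ Set.Ici m, H n := by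
        intro ω hω
        simp only [Set.mem_ofPred_eq, Classical.not_imp, not_forall, not_not] at hω
        obtain ⟨hc, t, htT, ht⟩ := hω
        -- the grid point just below the zero `t`
        have hlim : Tendsto (fun n : ℕ => (⌊(t : ℝ) * (n + 1)⌋₊ / (n + 1) : ℝ≥0)) atTop (𝓝 t) := by
          have := (tendsto_nat_floor_mul_div_atTop t.2).comp
            (tendsto_natCast_atTop_atTop.comp (tendsto_add_atTop_nat 1))
          refine NNReal.tendsto_coe.1 (this.congr fun n => ?_)
          simp
        have hlim2 : Tendsto (fun n : ℕ => ‖F (Z (⌊(t : ℝ) * (n + 1)⌋₊ / (n + 1) : ℝ≥0) ω)‖)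
            atTop (𝓝 0) := by
          have hcc : Continuous fun t => ‖F (Z t ω)‖ := (hF.continuous.comp hc).norm
          have := (hcc.tendsto t).comp hlim
          simpa only [ht, norm_zero, Function.comp_def] using this
        obtain ⟨m, hm⟩ := eventually_atTop.1 (hlim2.eventually_lt_const hε)
        refine Set.mem_iUnion.2 ⟨m, Set.mem_iInter₂.2 fun n hn hav => ?_⟩
        have hle : ⌊(t : ℝ) * (n + 1)⌋₊ ≤ T * (n + 1) := by
          refine Nat.floor_le_of_le ?_
          push_cast
          gcongr
          exact_mod_cast htT
        exact (hav _ hle).not_gt (hm n hn)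
      have hmono : Monotone fun m => ⋂ n ∈ Set.Ici m, H n := fun a b hab =>
        Set.biInter_mono (Set.Ici_subset_Ici.2 hab) fun _ _ => le_rfl
      calc _ ≤ (μ (⋃ m, ⋂ n ∈ Set.Ici m, H n)) * ENNReal.ofReal (Real.log ε⁻¹) := by gcongr
        _ = ⨆ m, μ (⋂ n ∈ Set.Ici m, H n) * ENNReal.ofReal (Real.log ε⁻¹) := by
          rw [hmono.measure_iUnion, ENNReal.iSup_mul]
        _ ≤ ENNReal.ofReal K := iSup_le fun m => le_trans (by
          gcongr; exact Set.biInter_subset_of_mem Set.self_mem_Ici) (hH m)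
    rw [ae_iff]
    set p := μ {ω | ¬ ((Continuous fun t => Z t ω) → ∀ t : ℝ≥0, t ≤ T → F (Z t ω) ≠ 0)}
    by_contra hp
    have hlim : Tendsto (fun ε : ℝ => p * ENNReal.ofReal (Real.log ε⁻¹)) (𝓝[>] 0) (𝓝 ⊤) := by
      have h := ENNReal.Tendsto.const_mul (a := p) (ENNReal.tendsto_ofReal_atTop.comp
        (Real.tendsto_log_atTop.comp tendsto_inv_nhdsGT_zero)) (Or.inl ENNReal.top_ne_zero)
      rwa [ENNReal.mul_top hp] at h
    have hev : ∀ᶠ ε : ℝ in 𝓝[>] 0, p * ENNReal.ofReal (Real.log ε⁻¹) ≤ ENNReal.ofReal K := by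
      have hpos : 0 < min 1 ‖F z₀‖ := lt_min one_pos (norm_pos_iff.2 hF₀)
      filter_upwards [Ioo_mem_nhdsGT hpos] with ε hε
      exact hbound ε hε.1 (hε.2.le.trans (min_le_left _ _)) (hε.2.trans_le (min_le_right _ _))
    exact ENNReal.ofReal_ne_top (top_le_iff.1 (le_of_tendsto hlim hev))
  filter_upwards [ae_all_iff.2 hmain, hZ.cont] with ω h hc t
  obtain ⟨T, hT⟩ := exists_nat_ge t
  exact h T hc t hT

end HasRotationInvariantIncrements

/-! ### Rotation invariance of the increments of the matrix Brownian motion -/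

/-- A complex Gaussian vector whose real and imaginary parts are independent, centered and have
the same law is rotation invariant: up to the factor `c`, the multiplication by `exp (iθ)` rotates
the pair of the real and the imaginary part. -/
theorem isRotationInvariant_map_of_prod {Ω κ : Type*} [Fintype κ] [MeasurableSpace Ω]
    {μ : Measure Ω} {ν : Measure (κ → ℝ)} [IsGaussian ν] (hν : ν[id] = 0) {X Y : Ω → κ → ℝ}
    (hX : Measurable X) (hY : Measurable Y) (hXY : μ.map (fun ω => (X ω, Y ω)) = ν.prod ν)
    (c : ℂ) :
    IsRotationInvariant (μ.map fun ω p => c * ((X ω p : ℂ) + Complex.I * (Y ω p : ℂ))) := by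
  intro θ
  set G : (κ → ℝ) × (κ → ℝ) → κ → ℂ := fun q p => c * ((q.1 p : ℂ) + Complex.I * (q.2 p : ℂ))
  have hG : Measurable G := Continuous.measurable (by fun_prop)
  have hmap : (μ.map fun ω p => c * ((X ω p : ℂ) + Complex.I * (Y ω p : ℂ))) =
      (ν.prod ν).map G := by
    rw [← hXY, Measure.map_map hG (hX.prodMk hY)]
    rfl
  have hrot := IsGaussian.map_rotation_eq_self hν (-θ)
  have hcomp : (fun w : κ → ℂ => circleMap 0 1 θ • w) ∘ G =
      G ∘ ContinuousLinearMap.rotation (-θ) := by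
    ext q p
    simp only [G, Function.comp_apply, ContinuousLinearMap.rotation_apply, Pi.smul_apply,
      Pi.add_apply, smul_eq_mul, Real.cos_neg, Real.sin_neg, circleMap, zero_add,
      Complex.exp_mul_I]
    push_cast
    linear_combination (c * Complex.sin θ * (q.2 p)) * Complex.I_sq
  rw [hmap, Measure.map_map (by fun_prop) hG, hcomp, ← Measure.map_map hG (by fun_prop), hrot]

namespace Overlap

variable {Ω : Type*} [mΩ : MeasurableSpace Ω] {μ : Measure Ω}
  {𝓕 : Filtration ℝ≥0 mΩ} {N : ℕ} {B : Fin 2 × Fin N × Fin N → ℝ≥0 → Ω → ℝ}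

/-- The entries of `matrixBM m₀ B`, as a process with values in a normed space. -/
noncomputable def entriesBM (m₀ : Matrix (Fin N) (Fin N) ℂ)
    (B : Fin 2 × Fin N × Fin N → ℝ≥0 → Ω → ℝ) (t : ℝ≥0) (ω : Ω) : Fin N × Fin N → ℂ :=
  fun p => matrixBM m₀ B t ω p.1 p.2

theorem IsBrownianFamily.measurable (hB : IsBrownianFamily μ 𝓕 B) (i) (t : ℝ≥0) :
    Measurable (B i t) :=
  ((hB.adapted i t).mono (𝓕.le t)).measurable

omit mΩ in
theorem entriesBM_sub (m₀ : Matrix (Fin N) (Fin N) ℂ) (s t : ℝ≥0) (ω : Ω) :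
    entriesBM m₀ B t ω - entriesBM m₀ B s ω = fun p =>
      ((Real.sqrt (2 * N) : ℂ)⁻¹) * (((B (0, p) t ω - B (0, p) s ω : ℝ) : ℂ)
        + Complex.I * ((B (1, p) t ω - B (1, p) s ω : ℝ) : ℂ)) := by
  ext p
  simp only [entriesBM, matrixBM, Matrix.of_apply, Pi.sub_apply]
  push_cast
  ring

theorem IsBrownianFamily.isRotationInvariant_increment [IsProbabilityMeasure μ]
    (hB : IsBrownianFamily μ 𝓕 B) (m₀ : Matrix (Fin N) (Fin N) ℂ) (s t : ℝ≥0) :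
    IsRotationInvariant (μ.map fun ω => entriesBM m₀ B t ω - entriesBM m₀ B s ω) := by
  set D : Fin 2 × Fin N × Fin N → Ω → ℝ := fun i ω => B i t ω - B i s ω
  have hDm : ∀ i, Measurable (D i) := fun i => (hB.measurable i t).sub (hB.measurable i s)
  have hD : iIndepFun D μ :=
    hB.indep.comp (fun _ x => x t - x s) fun _ => by fun_prop
  have hlaw : ∀ i, HasLaw (D i) (gaussianReal 0 (nndist t.1 s.1)) μ :=
    fun i => (hB.brownian i).hasLaw_sub t s
  set X : Fin 2 → Ω → Fin N × Fin N → ℝ := fun a ω p => D (a, p) ω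
  have hXm : ∀ a, Measurable (X a) := fun a => measurable_pi_lambda _ fun p => hDm _
  have hXi : ∀ a, iIndepFun (fun p => D (a, p)) μ := fun a =>
    hD.precomp (g := fun p => (a, p)) fun _ _ h => (Prod.ext_iff.1 h).2
  set ν : Measure (Fin N × Fin N → ℝ) :=
    Measure.pi fun _ => gaussianReal 0 (nndist t.1 s.1)
  have hXlaw : ∀ a, μ.map (X a) = ν := fun a => by
    have := (iIndepFun_iff_map_fun_eq_pi_map fun p => (hDm (a, p)).aemeasurable).1 (hXi a)
    simp only [X, this, ν, fun i => (hlaw i).map_eq]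
  have hXg : HasGaussianLaw (X 0) μ :=
    (hXi 0).hasGaussianLaw fun p => (hlaw (0, p)).hasGaussianLaw
  have : IsGaussian ν := hXlaw 0 ▸ hXg.isGaussian_map
  have hν : ν[id] = 0 := by
    ext p
    rw [← hXlaw 0, integral_map (hXm 0).aemeasurable (by fun_prop), eval_integral]
    · simpa using (hlaw (0, p)).integral_eq.trans integral_id_gaussianReal
    · exact fun p => (hlaw (0, p)).hasGaussianLaw.integrable
  have hind : IndepFun (X 0) (X 1) μ := by
    have h := hD.indepFun_finset (Finset.univ.filter fun i => i.1 = 0)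
      (Finset.univ.filter fun i => i.1 = 1) (by
        rw [Finset.disjoint_left]
        intro i hi hi'
        simp_all) hDm
    exact h.comp
      (φ := fun x p => x ⟨(0, p), by simp⟩) (ψ := fun x p => x ⟨(1, p), by simp⟩)
      (measurable_pi_lambda _ fun _ => measurable_pi_apply _)
      (measurable_pi_lambda _ fun _ => measurable_pi_apply _)
  have hXY : μ.map (fun ω => (X 0 ω, X 1 ω)) = ν.prod ν := by
    rw [hind.map_prod_eq_prod_map_map (hXm 0).aemeasurable (hXm 1).aemeasurable, hXlaw, hXlaw]
  simp_rw [entriesBM_sub]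
  exact isRotationInvariant_map_of_prod hν (hXm 0) (hXm 1) hXY _

theorem IsBrownianFamily.hasRotationInvariantIncrements [IsProbabilityMeasure μ]
    (hB : IsBrownianFamily μ 𝓕 B) (m₀ : Matrix (Fin N) (Fin N) ℂ) :
    HasRotationInvariantIncrements μ 𝓕 (fun p => m₀ p.1 p.2) (entriesBM m₀ B) where
  initial := by
    filter_upwards [ae_all_iff.2 fun i => (hB.brownian i).eval_zero_ae_eq_zero] with ω hω
    ext p
    simp [entriesBM, matrixBM, hω]
  cont := by
    filter_upwards [ae_all_iff.2 fun i => (hB.brownian i).cont] with ω hω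
    refine continuous_pi fun p => ?_
    have h0 := hω (0, p)
    have h1 := hω (1, p)
    simp only [entriesBM, matrixBM, Matrix.of_apply]
    fun_prop
  measurable t := by
    have hg : Measurable fun (x : Fin 2 × Fin N × Fin N → ℝ) (p : Fin N × Fin N) =>
        m₀ p.1 p.2 + ((x (0, p) : ℂ) + Complex.I * (x (1, p) : ℂ)) / (Real.sqrt (2 * N) : ℂ) :=
      Continuous.measurable (by fun_prop)
    exact hg.comp (@measurable_pi_lambda _ _ _ (𝓕 t) _ _ fun i => (hB.adapted i t).measurable)
  indep s t hst := by
    refine indep_of_indep_of_le_left (hB.indep_past s t hst) ?_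
    simp_rw [entriesBM_sub]
    have hg : Measurable fun (x : Fin 2 × Fin N × Fin N → ℝ) (p : Fin N × Fin N) =>
        ((Real.sqrt (2 * N) : ℂ)⁻¹) * ((x (0, p) : ℂ) + Complex.I * (x (1, p) : ℂ)) :=
      Continuous.measurable (by fun_prop)
    have := hg.comp (comap_measurable (fun ω i => B i t ω - B i s ω))
    exact this.comap_le
  rotation s t _ := hB.isRotationInvariant_increment m₀ s t

theorem IsBrownianFamily.integrable_entriesBM [IsProbabilityMeasure μ]
    (hB : IsBrownianFamily μ 𝓕 B) (m₀ : Matrix (Fin N) (Fin N) ℂ) (t : ℝ≥0) (p : Fin N × Fin N) :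
    Integrable (fun ω => entriesBM m₀ B t ω p) μ := by
  have h : ∀ i, Integrable (fun ω => (B i t ω : ℂ)) μ := fun i =>
    ((hB.brownian i).integrable_eval t).ofReal
  exact (integrable_const _).add (((h (0, p)).add ((h (1, p)).const_mul _)).div_const _)

end Overlap

/-! ### Logarithmic integrability of polynomials -/

theorem elogNorm_add_le (x y : ℂ) :
    elogNorm (x + y) ≤ elogNorm x + elogNorm y + ENNReal.ofReal (Real.log 2) := by
  unfold elogNorm
  rw [← ENNReal.ofReal_add Real.posLog_nonneg Real.posLog_nonneg,
    ← ENNReal.ofReal_add (add_nonneg Real.posLog_nonneg Real.posLog_nonneg)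
      (Real.log_nonneg one_le_two)]
  exact ENNReal.ofReal_le_ofReal (Real.posLog_norm_add_le x y)

theorem elogNorm_le_enorm (x : ℂ) : elogNorm x ≤ ‖x‖ₑ := by
  rw [elogNorm, ← ofReal_norm]
  refine ENNReal.ofReal_le_ofReal ?_
  rw [Real.posLog_apply]
  exact max_le (norm_nonneg x) (Real.log_le_self (norm_nonneg x))

theorem lintegral_elogNorm_eval_ne_top {Ω κ : Type*} [MeasurableSpace Ω] {μ : Measure Ω}
    [IsProbabilityMeasure μ] {Z : Ω → κ → ℂ} (hZ : ∀ p, Integrable (fun ω => Z ω p) μ)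
    (q : MvPolynomial κ ℂ) : ∫⁻ ω, elogNorm (MvPolynomial.eval (Z ω) q) ∂μ ≠ ⊤ := by
  have hm : ∀ q, AEMeasurable (fun ω => elogNorm (MvPolynomial.eval (Z ω) q)) μ := by
    intro q
    refine continuous_elogNorm.measurable.comp_aemeasurable ?_
    induction q using MvPolynomial.induction_on with
    | C a => simp
    | add p q hp hq =>
      simp only [map_add]
      exact hp.add hq
    | mul_X p i hp =>
      simp only [map_mul, MvPolynomial.eval_X]
      exact hp.mul (hZ i).aemeasurable
  induction q using MvPolynomial.induction_on with
  | C a => simp [elogNorm]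
  | add p q hp hq =>
    simp only [map_add]
    refine ne_top_of_le_ne_top ?_ (lintegral_mono fun ω => elogNorm_add_le _ _)
    rw [lintegral_add_right _ measurable_const, lintegral_add_left' (hm p)]
    simp [hp, hq]
  | mul_X p i hp =>
    simp only [map_mul, MvPolynomial.eval_X]
    refine ne_top_of_le_ne_top ?_ (lintegral_mono fun ω =>
      (elogNorm_mul_le _ _).trans (add_le_add_right (elogNorm_le_enorm _) _))
    rw [lintegral_add_left' (hm p)]
    exact ENNReal.add_ne_top.2 ⟨hp, (hZ i).2.ne⟩

theorem MvPolynomial.differentiable_eval {κ : Type*} [Fintype κ] (q : MvPolynomial κ ℂ) :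
    Differentiable ℂ fun z : κ → ℂ => MvPolynomial.eval z q := by
  induction q using MvPolynomial.induction_on with
  | C a => simp
  | add p q hp hq =>
    simp only [map_add]
    exact hp.add hq
  | mul_X p i hp =>
    simp only [map_mul, MvPolynomial.eval_X]
    exact hp.mul (differentiable_apply i)

/-! ### The discriminant and simplicity of the spectrum -/

/-- The resultant of the characteristic polynomial and its derivative, as a polynomial in the
entries of the matrix. The degrees in the resultant are fixed to `N` and `N - 1`, so that it
commutes with evaluation at a matrix. -/
noncomputable def charpolyDiscr (N : ℕ) : MvPolynomial (Fin N × Fin N) ℂ :=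
  Polynomial.resultant (Matrix.charpoly.univ ℂ (Fin N))
    (Polynomial.derivative (Matrix.charpoly.univ ℂ (Fin N))) N (N - 1)

theorem eval_charpolyDiscr_ne_zero_iff {N : ℕ} (A : Matrix (Fin N) (Fin N) ℂ) :
    MvPolynomial.eval (fun p => A p.1 p.2) (charpolyDiscr N) ≠ 0 ↔ A.charpoly.roots.Nodup := by
  have hA : (Matrix.charpoly.univ ℂ (Fin N)).map (MvPolynomial.eval fun p => A p.1 p.2) =
      A.charpoly :=
    Matrix.charpoly.univ_map_eval₂Hom (Fin N) (RingHom.id ℂ) fun p => A p.1 p.2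
  have hdeg : A.charpoly.natDegree = N := by simp [Matrix.charpoly_natDegree_eq_dim]
  have hdeg' : (Polynomial.derivative A.charpoly).natDegree = N - 1 := by
    rw [Polynomial.natDegree_derivative, hdeg]
  have h0 : A.charpoly ≠ 0 := A.charpoly_monic.ne_zero
  have heval : MvPolynomial.eval (fun p => A p.1 p.2) (charpolyDiscr N) =
      Polynomial.resultant A.charpoly (Polynomial.derivative A.charpoly) := by
    rw [charpolyDiscr, ← Polynomial.resultant_map_map, ← Polynomial.derivative_map, hA, hdeg,
      hdeg']
  rw [heval, Ne, Polynomial.resultant_eq_zero_iff,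
    Polynomial.nodup_roots_iff_of_splits h0 (IsAlgClosed.splits _), Polynomial.Separable]
  simp [h0]

namespace Overlap

/-- The non-Hermitian matrix valued Brownian motion started from a matrix with simple spectrum
almost surely has simple spectrum at all times. -/
theorem IsBrownianFamily.ae_forall_nodup_roots {Ω : Type*} [mΩ : MeasurableSpace Ω]
    {μ : Measure Ω} [IsProbabilityMeasure μ] {𝓕 : Filtration ℝ≥0 mΩ} {N : ℕ}
    {B : Fin 2 × Fin N × Fin N → ℝ≥0 → Ω → ℝ} (hB : IsBrownianFamily μ 𝓕 B)
    {m₀ : Matrix (Fin N) (Fin N) ℂ} (hm₀ : m₀.charpoly.roots.Nodup) :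
    ∀ᵐ ω ∂μ, ∀ t, (matrixBM m₀ B t ω).charpoly.roots.Nodup := by
  filter_upwards [(hB.hasRotationInvariantIncrements m₀).ae_forall_ne_zero
    (charpolyDiscr N).differentiable_eval ((eval_charpolyDiscr_ne_zero_iff m₀).2 hm₀)
    fun t => lintegral_elogNorm_eval_ne_top (hB.integrable_entriesBM m₀ t) _] with ω hω t
  exact (eval_charpolyDiscr_ne_zero_iff _).1 (hω t)

theorem IsEigenvalueProcess.ae_forall_injective {Ω : Type*} [mΩ : MeasurableSpace Ω]
    {μ : Measure Ω} {𝓕 : Filtration ℝ≥0 mΩ} {N : ℕ}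
    {M : ℝ≥0 → Ω → Matrix (Fin N) (Fin N) ℂ} {Λ : ℝ≥0 → Ω → Fin N → ℂ}
    (hΛ : IsEigenvalueProcess μ 𝓕 M Λ) (hM : ∀ᵐ ω ∂μ, ∀ t, (M t ω).charpoly.roots.Nodup) :
    ∀ᵐ ω ∂μ, ∀ t, Function.Injective (Λ t ω) := by
  filter_upwards [hΛ.charpoly, hM] with ω h1 h2 t
  have h := h2 t
  rw [h1 t, Polynomial.roots_prod _ _ (Finset.prod_ne_zero_iff.2 fun j _ =>
    Polynomial.X_sub_C_ne_zero _)] at h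
  simp only [Polynomial.roots_X_sub_C, Multiset.bind_singleton] at h
  exact fun i j hij => Multiset.inj_on_of_nodup_map h i (by simp) j (by simp) hij

end Overlap

/-! ### Bi-orthogonal systems of eigenvectors of a single matrix -/

namespace Overlap

variable {N : ℕ}

theorem exists_biorthogonal_eigenvectors {A : Matrix (Fin N) (Fin N) ℂ} {lam : Fin N → ℂ}
    (hA : A.charpoly = ∏ j, (Polynomial.X - Polynomial.C (lam j)))
    (hlam : Function.Injective lam) :
    ∃ r l : Fin N → Fin N → ℂ, (∀ j, A *ᵥ r j = lam j • r j) ∧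
      (∀ j, l j ᵥ* A = lam j • l j) ∧ ∀ j k, l j ⬝ᵥ r k = if j = k then 1 else 0 := by
  have hex : ∀ j, ∃ v : Fin N → ℂ, v ≠ 0 ∧ A *ᵥ v = lam j • v := by
    intro j
    have hdet : (Matrix.scalar (Fin N) (lam j) - A).det = 0 := by
      rw [← Matrix.eval_charpoly, hA, Polynomial.eval_prod]
      exact Finset.prod_eq_zero (Finset.mem_univ j) (by simp)
    obtain ⟨v, hv, h⟩ := Matrix.exists_mulVec_eq_zero_iff.2 hdet
    refine ⟨v, hv, ?_⟩
    rw [Matrix.sub_mulVec, sub_eq_zero] at h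
    rw [← h, Matrix.scalar_apply, Matrix.diagonal_const_mulVec]
  choose r hr0 hr using hex
  have hli : LinearIndependent ℂ r :=
    Module.End.eigenvectors_linearIndependent' (Matrix.toLin' A) lam hlam r fun j =>
      ⟨Module.End.mem_eigenspace_iff.2 (by simpa using hr j), hr0 j⟩
  have hunit : IsUnit (matS r) := Matrix.linearIndependent_cols_iff_isUnit.1 hli
  have hdet : IsUnit (matS r).det := (Matrix.isUnit_iff_isUnit_det _).1 hunit
  have hAS : A * matS r = matS r * Matrix.diagonal lam := by
    ext i j
    rw [Matrix.mul_diagonal]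
    simpa [mul_comm] using! congrFun (hr j) i
  have hSA : (matS r)⁻¹ * A = Matrix.diagonal lam * (matS r)⁻¹ := by
    calc (matS r)⁻¹ * A = (matS r)⁻¹ * (A * matS r) * (matS r)⁻¹ := by
          rw [Matrix.mul_assoc, Matrix.mul_assoc, Matrix.mul_nonsing_inv _ hdet, Matrix.mul_one]
      _ = _ := by
          rw [hAS, ← Matrix.mul_assoc (matS r)⁻¹, Matrix.nonsing_inv_mul _ hdet, Matrix.one_mul]
  refine ⟨r, fun j => (matS r)⁻¹ j, hr, fun j => ?_, fun j k => ?_⟩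
  · ext i
    have := congrFun (congrFun hSA j) i
    rw [Matrix.diagonal_mul] at this
    exact this
  · have := congrFun (congrFun (Matrix.nonsing_inv_mul _ hdet) j) k
    rw [Matrix.one_apply] at this
    exact this

/-- Bi-orthogonal systems of eigenvectors of a matrix with simple spectrum are unique up to a
scale transformation. -/
theorem exists_scale_of_biorthogonal {A : Matrix (Fin N) (Fin N) ℂ} {lam : Fin N → ℂ}
    (hlam : Function.Injective lam) {r l r' l' : Fin N → Fin N → ℂ}
    (hr : ∀ j, A *ᵥ r j = lam j • r j) (hl : ∀ j, l j ᵥ* A = lam j • l j)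
    (hlr : ∀ j k, l j ⬝ᵥ r k = if j = k then 1 else 0)
    (hr' : ∀ j, A *ᵥ r' j = lam j • r' j) (hl' : ∀ j, l' j ᵥ* A = lam j • l' j)
    (hlr' : ∀ j k, l' j ⬝ᵥ r' k = if j = k then 1 else 0) :
    ∃ c : Fin N → ℂ, (∀ j, c j ≠ 0) ∧ (r' = fun j => c j • r j) ∧
      l' = fun j => (1 / c j) • l j := by
  -- left and right eigenvectors for different eigenvalues are orthogonal
  have horth : ∀ {u v : Fin N → Fin N → ℂ}, (∀ j, u j ᵥ* A = lam j • u j) →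
      (∀ j, A *ᵥ v j = lam j • v j) → ∀ j k, j ≠ k → u j ⬝ᵥ v k = 0 := by
    intro u v hu hv j k hjk
    have h : lam j * (u j ⬝ᵥ v k) = lam k * (u j ⬝ᵥ v k) := by
      have := Matrix.dotProduct_mulVec (u j) A (v k)
      rw [hu, hv, dotProduct_smul, smul_dotProduct] at this
      exact this.symm
    by_contra h0
    exact hjk (hlam (mul_right_cancel₀ h0 h))
  have hinv : matSinv l * matS r = 1 := by
    ext j k
    rw [Matrix.one_apply, ← hlr j k]
    rfl
  have hinv' : matS r * matSinv l = 1 := mul_eq_one_comm.1 hinv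
  have hexp : ∀ v : Fin N → ℂ, v = ∑ k, (l k ⬝ᵥ v) • r k := by
    intro v
    have h : matS r *ᵥ (matSinv l *ᵥ v) = v := by
      rw [Matrix.mulVec_mulVec, hinv', Matrix.one_mulVec]
    ext i
    conv_lhs => rw [← h]
    simp [Matrix.mulVec, dotProduct, matS, matSinv, mul_comm]
  have hexp' : ∀ v : Fin N → ℂ, v = ∑ k, (v ⬝ᵥ r k) • l k := by
    intro v
    have h : (v ᵥ* matS r) ᵥ* matSinv l = v := by
      rw [Matrix.vecMul_vecMul, hinv', Matrix.vecMul_one]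
    ext i
    conv_lhs => rw [← h]
    simp [Matrix.vecMul, dotProduct, matS, matSinv]
  have h1 : ∀ j, r' j = (l j ⬝ᵥ r' j) • r j := by
    intro j
    conv_lhs => rw [hexp (r' j)]
    exact Finset.sum_eq_single j (fun k _ hk => by rw [horth hl hr' k j hk, zero_smul]) (by simp)
  have h2 : ∀ j, l' j = (l' j ⬝ᵥ r j) • l j := by
    intro j
    conv_lhs => rw [hexp' (l' j)]
    exact Finset.sum_eq_single j (fun k _ hk => by rw [horth hl' hr j k hk.symm, zero_smul])
      (by simp)
  have h3 : ∀ j, (l' j ⬝ᵥ r j) * (l j ⬝ᵥ r' j) = 1 := by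
    intro j
    have := hlr' j j
    rw [h1 j, dotProduct_smul, if_pos rfl, smul_eq_mul, mul_comm] at this
    exact this
  refine ⟨fun j => l j ⬝ᵥ r' j, fun j => right_ne_zero_of_mul_eq_one (h3 j), funext h1,
    funext fun j => ?_⟩
  rw [one_div, ← eq_inv_of_mul_eq_one_left (h3 j)]
  exact h2 j

/-! ### Invariance under the scale transformation -/

variable {c : Fin N → ℂ} (r l : Fin N → Fin N → ℂ)

theorem matS_scale (c : Fin N → ℂ) (j k : Fin N) :
    matS (fun j => c j • r j) j k = c k * matS r j k := rfl

theorem matA_scale (c : Fin N → ℂ) (j k : Fin N) :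
    matA (fun j => c j • r j) j k = star (c j) * c k * matA r j k := by
  simp only [matA, Matrix.mul_apply, Matrix.conjTranspose_apply, matS_scale, star_mul',
    Finset.mul_sum]
  exact Finset.sum_congr rfl fun _ _ => by ring

theorem matAinv_scale (c : Fin N → ℂ) (j k : Fin N) :
    matAinv (fun j => (1 / c j) • l j) j k = (c j)⁻¹ * (star (c k))⁻¹ * matAinv l j k := by
  simp only [matAinv, matSinv, Matrix.mul_apply, Matrix.conjTranspose_apply, Matrix.of_apply,
    Pi.smul_apply, smul_eq_mul, star_mul', Finset.mul_sum, one_div, star_inv₀]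
  exact Finset.sum_congr rfl fun _ _ => by ring

theorem matSinv_mul_mul_matS_scale (c : Fin N → ℂ) (dM : Matrix (Fin N) (Fin N) ℂ)
    (j k : Fin N) :
    (matSinv (fun j => (1 / c j) • l j) * dM * matS (fun j => c j • r j)) j k =
      (c j)⁻¹ * c k * (matSinv l * dM * matS r) j k := by
  simp only [matSinv, Matrix.mul_apply, Matrix.of_apply, Pi.smul_apply, smul_eq_mul, matS_scale,
    Finset.mul_sum, Finset.sum_mul, one_div]
  exact Finset.sum_congr rfl fun _ _ => Finset.sum_congr rfl fun _ _ => by ring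

theorem overlap_scale (hc : ∀ j, c j ≠ 0) :
    overlap (fun j => c j • r j) (fun j => (1 / c j) • l j) = overlap r l := by
  ext j k
  have hj := hc j
  have hk : star (c k) ≠ 0 := star_ne_zero.2 (hc k)
  simp only [overlap, Matrix.of_apply, matA_scale, matAinv_scale]
  field_simp

theorem martIncr_scale (hc : ∀ j, c j ≠ 0) (lam : Fin N → ℂ) :
    martIncr lam (fun j => c j • r j) (fun j => (1 / c j) • l j) = martIncr lam r l := by
  have hcs : ∀ k, star (c k) ≠ 0 := fun k => star_ne_zero.2 (hc k)
  ext j k dM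
  simp only [martIncr, matA_scale, matAinv_scale, matSinv_mul_mul_matS_scale, star_mul', star_inv₀]
  congr 1
  · refine Finset.sum_congr rfl fun ℓ _ => ?_
    have h1 := hc j
    have h2 := hcs k
    have h3 := hc ℓ
    congr 1
    field_simp
  · refine Finset.sum_congr rfl fun ℓ _ => ?_
    have h1 := hc j
    have h2 := hcs k
    have h3 := hcs ℓ
    congr 1
    field_simp

end Overlap

/-! ### Uniqueness of Itô integrals -/

namespace Overlap

theorem exists_isPartitionSeq (t : ℝ≥0) : ∃ n π, IsPartitionSeq t n π := by
  refine ⟨fun r => r + 1, fun r i => min ((i : ℝ≥0) / ((r : ℝ≥0) + 1)) 1 * t, ?_, ?_, ?_, ?_⟩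
  · intro r i j hij
    dsimp only
    gcongr
  · simp
  · intro r
    have : ((r : ℝ≥0) + 1) ≠ 0 := by positivity
    simp [this]
  · intro ε hε
    have hlim : Tendsto (fun r : ℕ => t * (1 / ((r : ℝ≥0) + 1))) atTop (𝓝 0) := by
      have : Tendsto (fun r : ℕ => 1 / ((r : ℝ≥0) + 1)) atTop (𝓝 0) :=
        NNReal.tendsto_coe.1 (by simpa using tendsto_one_div_add_atTop_nhds_zero_nat (𝕜 := ℝ))
      simpa using this.const_mul t
    filter_upwards [hlim.eventually_le_const hε] with r hr i _
    refine le_trans ?_ hr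
    rw [tsub_le_iff_left, mul_comm t, ← add_mul]
    gcongr
    rw [← min_add_add_right, Nat.cast_add_one, add_div]
    exact min_le_min le_rfl (by simp)

/-- Integrands which agree almost surely at all times have the same Itô integral. -/
theorem IsItoIntegral.ae_forall_eq {Ω E : Type*} [MeasurableSpace Ω] [Sub E] {μ : Measure Ω}
    {H H' : ℝ≥0 → Ω → E → ℂ} {Z : ℝ≥0 → Ω → E} {I I' : ℝ≥0 → Ω → ℂ}
    (hI : IsItoIntegral μ H Z I) (hI' : IsItoIntegral μ H' Z I')
    (hH : ∀ᵐ ω ∂μ, ∀ t, H t ω = H' t ω) : ∀ᵐ ω ∂μ, ∀ t, I t ω = I' t ω := by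
  have hpt : ∀ t, I t =ᵐ[μ] I' t := by
    intro t
    obtain ⟨n, π, hπ⟩ := exists_isPartitionSeq t
    refine tendstoInMeasure_ae_unique (hI.tendsto t n π hπ)
      ((hI'.tendsto t n π hπ).congr_left fun r => ?_)
    filter_upwards [hH] with ω hω
    simp only [hω]
  filter_upwards [ae_all_iff.2 fun i => hpt (TopologicalSpace.denseSeq ℝ≥0 i), hI.cont, hI'.cont]
    with ω h hc hc'
  have := Continuous.ext_on (TopologicalSpace.denseRange_denseSeq ℝ≥0) hc hc'
    (by rintro _ ⟨i, rfl⟩; exact h i)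
  exact congrFun this

/-! ### Pathwise uniqueness for the drift -/

variable {N : ℕ}

theorem drift_sub_drift (lam : Fin N → ℂ) (o o' : Matrix (Fin N) (Fin N) ℂ) (j k : Fin N) :
    drift lam o j k - drift lam o' j k = 2 / (N : ℂ) *
      ∑ ℓ ∈ Finset.univ.filter (fun ℓ => ℓ ≠ j), ∑ m ∈ Finset.univ.filter (fun m => m ≠ k),
        ((o - o') j k * o ℓ m + o' j k * (o - o') ℓ m + ((o - o') ℓ k * o j m
          + o' ℓ k * (o - o') j m)) / ((lam j - lam ℓ) * (star (lam k) - star (lam m))) := by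
  simp only [drift, ← mul_sub, ← Finset.sum_sub_distrib, ← sub_div]
  congr 1
  refine Finset.sum_congr rfl fun ℓ _ => Finset.sum_congr rfl fun m _ => ?_
  congr 1
  simp only [Matrix.sub_apply]
  ring

/-- A Lipschitz constant of the drift on the pair `o`, `o'`, continuous in `lam`, `o`, `o'` as long
as the `lam j` are distinct. -/
noncomputable def driftLip (lam : Fin N → ℂ) (o o' : Matrix (Fin N) (Fin N) ℂ) (j k : Fin N) : ℝ :=
  ‖2 / (N : ℂ)‖ *
    ∑ ℓ ∈ Finset.univ.filter (fun ℓ => ℓ ≠ j), ∑ m ∈ Finset.univ.filter (fun m => m ≠ k),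
      (‖o ℓ m‖ + ‖o' j k‖ + (‖o j m‖ + ‖o' ℓ k‖))
        / ‖(lam j - lam ℓ) * (star (lam k) - star (lam m))‖

theorem norm_drift_sub_drift_le (lam : Fin N → ℂ) (o o' : Matrix (Fin N) (Fin N) ℂ) (j k : Fin N)
    {δ : ℝ} (hδ : ∀ a b, ‖(o - o') a b‖ ≤ δ) :
    ‖drift lam o j k - drift lam o' j k‖ ≤ driftLip lam o o' j k * δ := by
  have hmul : ∀ (a b : Fin N) (x : ℂ), ‖(o - o') a b * x‖ ≤ ‖x‖ * δ := fun a b x => by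
    rw [norm_mul, mul_comm]
    gcongr
    exact hδ a b
  rw [drift_sub_drift, driftLip, norm_mul, mul_assoc, Finset.sum_mul]
  gcongr
  refine norm_sum_le_of_le _ fun ℓ _ => ?_
  rw [Finset.sum_mul]
  refine norm_sum_le_of_le _ fun m _ => ?_
  rw [norm_div, div_mul_eq_mul_div]
  gcongr
  calc _ ≤ ‖(o - o') j k * o ℓ m‖ + ‖o' j k * (o - o') ℓ m‖
        + (‖(o - o') ℓ k * o j m‖ + ‖o' ℓ k * (o - o') j m‖) :=
        norm_add_le_of_le (norm_add_le _ _) (norm_add_le _ _)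
    _ ≤ ‖o ℓ m‖ * δ + ‖o' j k‖ * δ + (‖o j m‖ * δ + ‖o' ℓ k‖ * δ) := by
        rw [mul_comm (o' j k), mul_comm (o' ℓ k)]
        gcongr <;> exact hmul _ _ _
    _ = _ := by ring

theorem sub_mul_star_sub_ne_zero {lam : Fin N → ℂ} (hlam : Function.Injective lam)
    {j k ℓ m : Fin N} (hℓ : ℓ ≠ j) (hm : m ≠ k) :
    (lam j - lam ℓ) * (star (lam k) - star (lam m)) ≠ 0 := by
  refine mul_ne_zero (sub_ne_zero.2 fun h => hℓ (hlam h).symm) (sub_ne_zero.2 fun h => ?_)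
  exact hm (hlam (star_injective h)).symm

section Path

variable {lam : ℝ → Fin N → ℂ} {x x' : ℝ → Matrix (Fin N) (Fin N) ℂ}

theorem continuous_drift (hlam : Continuous lam) (hinj : ∀ s, Function.Injective (lam s))
    (hx : Continuous x) (j k : Fin N) : Continuous fun s => drift (lam s) (x s) j k := by
  have hl : ∀ i, Continuous fun s => lam s i := fun i => (continuous_apply i).comp hlam
  have hxe : ∀ a b, Continuous fun s => x s a b := fun a b => hx.matrix_elem a b
  refine continuous_const.mul (continuous_finsetSum _ fun ℓ hℓ => continuous_finsetSum _ fun m hm =>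
    Continuous.div (by fun_prop) (by fun_prop) fun s => ?_)
  exact sub_mul_star_sub_ne_zero (hinj s) (by simpa using hℓ) (by simpa using hm)

theorem continuous_driftLip (hlam : Continuous lam) (hinj : ∀ s, Function.Injective (lam s))
    (hx : Continuous x) (hx' : Continuous x') (j k : Fin N) :
    Continuous fun s => driftLip (lam s) (x s) (x' s) j k := by
  have hl : ∀ i, Continuous fun s => lam s i := fun i => (continuous_apply i).comp hlam
  have hxe : ∀ a b, Continuous fun s => x s a b := fun a b => hx.matrix_elem a b
  have hxe' : ∀ a b, Continuous fun s => x' s a b := fun a b => hx'.matrix_elem a b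
  refine continuous_const.mul (continuous_finsetSum _ fun ℓ hℓ => continuous_finsetSum _ fun m hm =>
    Continuous.div (by fun_prop) (by fun_prop) fun s => norm_ne_zero_iff.2 ?_)
  exact sub_mul_star_sub_ne_zero (hinj s) (by simpa using hℓ) (by simpa using hm)

/-- Two continuous paths driven by the same noise and by the drift of the overlap equations agree:
their difference is differentiable, and Grönwall's inequality applies because the drift is locally
Lipschitz as long as the eigenvalues are distinct. -/
theorem eq_of_sub_eq_integral_drift (hlam : Continuous lam)
    (hinj : ∀ s, Function.Injective (lam s)) (hx : Continuous x) (hx' : Continuous x')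
    (hint : ∀ t, 0 ≤ t → ∀ j k, x t j k - x' t j k =
      ∫ s in (0 : ℝ)..t, (drift (lam s) (x s) j k - drift (lam s) (x' s) j k)) :
    ∀ t, 0 ≤ t → x t = x' t := by
  intro T hT
  set h : ℝ → Fin N → Fin N → ℂ :=
    fun s j k => drift (lam s) (x s) j k - drift (lam s) (x' s) j k
  set g : ℝ → Fin N → Fin N → ℂ := fun t j k => ∫ s in (0 : ℝ)..t, h s j k
  have hg : ∀ t, 0 ≤ t → ∀ j k, g t j k = (x t - x' t) j k := fun t ht j k => (hint t ht j k).symm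
  have hcont : ∀ j k, Continuous fun s => h s j k := fun j k =>
    (continuous_drift hlam hinj hx j k).sub (continuous_drift hlam hinj hx' j k)
  have hderiv : ∀ t, HasDerivAt g (h t) t := fun t =>
    hasDerivAt_pi.2 fun j => hasDerivAt_pi.2 fun k =>
      intervalIntegral.integral_hasDerivAt_right ((hcont j k).intervalIntegrable _ _)
        ((hcont j k).stronglyMeasurableAtFilter _ _) (hcont j k).continuousAt
  set κ : ℝ → ℝ := fun s => ∑ j, ∑ k, driftLip (lam s) (x s) (x' s) j k
  have hκ : Continuous κ := continuous_finsetSum _ fun j _ => continuous_finsetSum _ fun k _ =>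
    continuous_driftLip hlam hinj hx hx' j k
  have hnonneg : ∀ s j k, 0 ≤ driftLip (lam s) (x s) (x' s) j k := fun s j k => by
    unfold driftLip; positivity
  obtain ⟨K, hK⟩ := (isCompact_Icc (a := (0 : ℝ)) (b := T)).bddAbove_image hκ.continuousOn
  have hbound : ∀ t ∈ Set.Ico 0 T, ‖h t‖ ≤ K * ‖g t‖ := by
    intro t ht
    have hK' : κ t ≤ K := hK ⟨t, ⟨ht.1, ht.2.le⟩, rfl⟩
    have hδ : ∀ a b, ‖(x t - x' t) a b‖ ≤ ‖g t‖ := fun a b => by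
      rw [← hg t ht.1]
      exact (norm_le_pi_norm (g t a) b).trans (norm_le_pi_norm (g t) a)
    have hle : ∀ j k, driftLip (lam t) (x t) (x' t) j k ≤ K := fun j k =>
      ((Finset.single_le_sum (f := fun k => driftLip (lam t) (x t) (x' t) j k)
        (fun k _ => hnonneg t j k) (Finset.mem_univ k)).trans
      (Finset.single_le_sum (f := fun j => ∑ k, driftLip (lam t) (x t) (x' t) j k)
        (fun j _ => Finset.sum_nonneg fun k _ => hnonneg t j k) (Finset.mem_univ j))).trans hK'
    have hK0 : 0 ≤ K := (Finset.sum_nonneg fun j _ => Finset.sum_nonneg fun k _ =>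
      hnonneg t j k).trans hK'
    have h0 : 0 ≤ K * ‖g t‖ := by positivity
    refine (pi_norm_le_iff_of_nonneg h0).2 fun j => (pi_norm_le_iff_of_nonneg h0).2 fun k => ?_
    refine (norm_drift_sub_drift_le _ _ _ j k hδ).trans ?_
    gcongr
    exact hle j k
  have hzero := eq_zero_of_abs_deriv_le_mul_abs_self_of_eq_zero_right (f := g) (f' := h) (K := K)
    (a := 0) (b := T) (fun t _ => (hderiv t).continuousAt.continuousWithinAt)
    (fun t _ => (hderiv t).hasDerivWithinAt) (by ext j k; simp [g]) hbound T ⟨hT, le_rfl⟩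
  ext j k
  have := hg T hT j k
  rw [hzero] at this
  exact (sub_eq_zero.1 this.symm)

end Path

/-! ### Solutions of the overlap equations -/

section Solution

variable {Ω : Type*} [mΩ : MeasurableSpace Ω] {μ : Measure Ω} {𝓕 : Filtration ℝ≥0 mΩ}
  {M : ℝ≥0 → Ω → Matrix (Fin N) (Fin N) ℂ} {Λ : ℝ≥0 → Ω → Fin N → ℂ}
  {R L R' L' : ℝ≥0 → Ω → Fin N → Fin N → ℂ} {X X' : ℝ≥0 → Ω → Matrix (Fin N) (Fin N) ℂ}

theorem IsEigenvectorProcess.scale (h : IsEigenvectorProcess μ M Λ R L)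
    {c : ℝ≥0 → Ω → Fin N → ℂ} (hc : ∀ t ω j, c t ω j ≠ 0) :
    IsEigenvectorProcess μ M Λ (scaleR c R) (scaleL c L) where
  right := by
    filter_upwards [h.right] with ω hω t j
    rw [scaleR, Matrix.mulVec_smul, hω, smul_comm]
  left := by
    filter_upwards [h.left] with ω hω t j
    rw [scaleL, Matrix.smul_vecMul, hω, smul_comm]
  biorth := by
    filter_upwards [h.biorth] with ω hω t j k
    rw [scaleL, scaleR, smul_dotProduct, dotProduct_smul, hω]
    split_ifs with hjk
    · subst hjk
      simp [hc]
    · simp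

/-- The overlap equations depend on the eigenvectors only through the initial overlaps and the
coefficients of the martingale part. -/
theorem IsOverlapSolution.congr (h : IsOverlapSolution μ 𝓕 M Λ R L X)
    (ho : ∀ t ω, overlap (R t ω) (L t ω) = overlap (R' t ω) (L' t ω))
    (hm : ∀ t ω, martIncr (Λ t ω) (R t ω) (L t ω) = martIncr (Λ t ω) (R' t ω) (L' t ω)) :
    IsOverlapSolution μ 𝓕 M Λ R' L' X where
  adapted := h.adapted
  cont := h.cont
  initial := by simpa only [ho] using h.initial
  integrable := h.integrable
  sde := by simpa only [hm] using h.sde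

/-- Solutions for two choices of eigenvectors with the same initial overlaps and the same martingale
coefficients agree: their Itô integrals cancel, and the drift determines the difference. -/
theorem IsOverlapSolution.ae_forall_eq (hX : IsOverlapSolution μ 𝓕 M Λ R L X)
    (hX' : IsOverlapSolution μ 𝓕 M Λ R' L' X') (hcont : ∀ᵐ ω ∂μ, Continuous fun t => Λ t ω)
    (hinj : ∀ᵐ ω ∂μ, ∀ t, Function.Injective (Λ t ω))
    (ho : ∀ᵐ ω ∂μ, overlap (R 0 ω) (L 0 ω) = overlap (R' 0 ω) (L' 0 ω))
    (hm : ∀ᵐ ω ∂μ, ∀ t, martIncr (Λ t ω) (R t ω) (L t ω) = martIncr (Λ t ω) (R' t ω) (L' t ω)) :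
    ∀ᵐ ω ∂μ, ∀ t, X t ω = X' t ω := by
  have hsub : ∀ j k, ∀ᵐ ω ∂μ, ∀ t : ℝ≥0, X t ω j k - X' t ω j k =
      (∫ s in (0 : ℝ)..t, drift (Λ s.toNNReal ω) (X s.toNNReal ω) j k)
        - ∫ s in (0 : ℝ)..t, drift (Λ s.toNNReal ω) (X' s.toNNReal ω) j k := by
    intro j k
    obtain ⟨I, hI, h⟩ := hX.sde j k
    obtain ⟨I', hI', h'⟩ := hX'.sde j k
    have hII' := hI.ae_forall_eq hI' (by
      filter_upwards [hm] with ω hω t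
      rw [hω])
    filter_upwards [h, h', hII', hX.initial, hX'.initial, ho] with ω h h' hII' h0 h0' ho t
    rw [h t, h' t, hII' t, h0, h0', ho]
    ring
  filter_upwards [ae_all_iff.2 fun j => ae_all_iff.2 fun k => hsub j k,
    ae_all_iff.2 fun j => ae_all_iff.2 fun k => hX.integrable j k,
    ae_all_iff.2 fun j => ae_all_iff.2 fun k => hX'.integrable j k,
    hX.cont, hX'.cont, hcont, hinj] with ω h hi hi' hc hc' hΛ hinj t
  have key := eq_of_sub_eq_integral_drift (lam := fun s => Λ s.toNNReal ω)
    (x := fun s => X s.toNNReal ω) (x' := fun s => X' s.toNNReal ω)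
    (hΛ.comp continuous_real_toNNReal) (fun s => hinj _) (hc.comp continuous_real_toNNReal)
    (hc'.comp continuous_real_toNNReal) (fun s hs j k => by
      lift s to ℝ≥0 using hs
      rw [intervalIntegral.integral_sub (hi j k s) (hi' j k s)]
      simpa using h j k s) t t.2
  simpa using key

end Solution

end Overlap

theorem theorem1p2 {Ω : Type*} [mΩ : MeasurableSpace Ω] (μ : Measure Ω) [IsProbabilityMeasure μ]
    (𝓕 : Filtration ℝ≥0 mΩ) (N : ℕ) (hN : 1 ≤ N)
    (B : Fin 2 × Fin N × Fin N → ℝ≥0 → Ω → ℝ) (hB : Overlap.IsBrownianFamily μ 𝓕 B)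
    (m₀ : Matrix (Fin N) (Fin N) ℂ) (hm₀ : m₀.charpoly.roots.Nodup)
    (Λ : ℝ≥0 → Ω → Fin N → ℂ)
    (hΛ : Overlap.IsEigenvalueProcess μ 𝓕 (Overlap.matrixBM m₀ B) Λ) :
    (∃ R L, Overlap.IsEigenvectorProcess μ (Overlap.matrixBM m₀ B) Λ R L) ∧
    ∀ R L, Overlap.IsEigenvectorProcess μ (Overlap.matrixBM m₀ B) Λ R L →
      -- invariance under the scale transformation
      (∀ c : ℝ≥0 → Ω → Fin N → ℂ, (∀ t ω j, c t ω j ≠ 0) →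
        Overlap.IsEigenvectorProcess μ (Overlap.matrixBM m₀ B) Λ
          (Overlap.scaleR c R) (Overlap.scaleL c L) ∧
        (∀ t ω, Overlap.overlap (Overlap.scaleR c R t ω) (Overlap.scaleL c L t ω)
          = Overlap.overlap (R t ω) (L t ω)) ∧
        ∀ X, Overlap.IsOverlapSolution μ 𝓕 (Overlap.matrixBM m₀ B) Λ R L X ↔
          Overlap.IsOverlapSolution μ 𝓕 (Overlap.matrixBM m₀ B) Λ
            (Overlap.scaleR c R) (Overlap.scaleL c L) X) ∧
      -- the eigenvector processes are not unique
      (∃ R' L', Overlap.IsEigenvectorProcess μ (Overlap.matrixBM m₀ B) Λ R' L' ∧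
        ∀ᵐ ω ∂μ, ∀ t j, R' t ω j ≠ R t ω j ∧ L' t ω j ≠ L t ω j) ∧
      -- the overlap process is unique
      (∀ R' L', Overlap.IsEigenvectorProcess μ (Overlap.matrixBM m₀ B) Λ R' L' →
        (∀ᵐ ω ∂μ, ∀ t, Overlap.overlap (R' t ω) (L' t ω) = Overlap.overlap (R t ω) (L t ω)) ∧
        ∀ X X', Overlap.IsOverlapSolution μ 𝓕 (Overlap.matrixBM m₀ B) Λ R L X →
          Overlap.IsOverlapSolution μ 𝓕 (Overlap.matrixBM m₀ B) Λ R' L' X' →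
          ∀ᵐ ω ∂μ, ∀ t, X t ω = X' t ω) := by
  have hinj := hΛ.ae_forall_injective (hB.ae_forall_nodup_roots hm₀)
  refine ⟨?_, fun R L hRL => ⟨fun c hc => ?_, ?_, fun R' L' hRL' => ?_⟩⟩
  · have hex : ∀ t ω, ∃ r l : Fin N → Fin N → ℂ,
        (Overlap.matrixBM m₀ B t ω).charpoly =
            ∏ j, (Polynomial.X - Polynomial.C (Λ t ω j)) →
          Function.Injective (Λ t ω) →
          (∀ j, Overlap.matrixBM m₀ B t ω *ᵥ r j = Λ t ω j • r j) ∧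
          (∀ j, l j ᵥ* Overlap.matrixBM m₀ B t ω = Λ t ω j • l j) ∧
          ∀ j k, l j ⬝ᵥ r k = if j = k then 1 else 0 := by
      intro t ω
      by_cases h : (Overlap.matrixBM m₀ B t ω).charpoly =
          ∏ j, (Polynomial.X - Polynomial.C (Λ t ω j)) ∧ Function.Injective (Λ t ω)
      · obtain ⟨r, l, hrl⟩ := Overlap.exists_biorthogonal_eigenvectors h.1 h.2
        exact ⟨r, l, fun _ _ => hrl⟩
      · exact ⟨0, 0, fun h1 h2 => absurd ⟨h1, h2⟩ h⟩
    choose R L h using hex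
    refine ⟨R, L, ?_, ?_, ?_⟩
    · filter_upwards [hΛ.charpoly, hinj] with ω h1 h2 t using (h t ω (h1 t) (h2 t)).1
    · filter_upwards [hΛ.charpoly, hinj] with ω h1 h2 t using (h t ω (h1 t) (h2 t)).2.1
    · filter_upwards [hΛ.charpoly, hinj] with ω h1 h2 t using (h t ω (h1 t) (h2 t)).2.2
  · have ho : ∀ t ω, Overlap.overlap (Overlap.scaleR c R t ω) (Overlap.scaleL c L t ω)
        = Overlap.overlap (R t ω) (L t ω) := fun t ω => Overlap.overlap_scale _ _ (hc t ω)
    have hm : ∀ t ω, Overlap.martIncr (Λ t ω) (Overlap.scaleR c R t ω) (Overlap.scaleL c L t ω)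
        = Overlap.martIncr (Λ t ω) (R t ω) (L t ω) :=
      fun t ω => Overlap.martIncr_scale _ _ (hc t ω) _
    exact ⟨hRL.scale hc, ho, fun X => ⟨fun h => h.congr (fun t ω => (ho t ω).symm)
      fun t ω => (hm t ω).symm, fun h => h.congr ho hm⟩⟩
  · -- doubling `R` and halving `L` moves every vector, none of them being zero
    refine ⟨_, _, hRL.scale (c := fun _ _ _ => 2) fun _ _ _ => two_ne_zero, ?_⟩
    filter_upwards [hRL.biorth] with ω hω t j
    have h := hω t j j
    rw [if_pos rfl] at h
    constructor
    · intro h2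
      have : R t ω j = 0 := by
        simpa [Overlap.scaleR, two_smul] using h2
      simp [this] at h
    · intro h2
      have h3 : L t ω j = (2 : ℂ) • L t ω j := by
        conv_rhs => rw [← h2]
        simp [Overlap.scaleL, smul_smul]
      have : L t ω j = 0 := by
        simpa [two_smul] using h3
      simp [this] at h
  · have hscale : ∀ᵐ ω ∂μ, ∀ t, ∃ c : Fin N → ℂ, (∀ j, c j ≠ 0) ∧
        (R' t ω = fun j => c j • R t ω j) ∧ L' t ω = fun j => (1 / c j) • L t ω j := by
      filter_upwards [hinj, hRL.right, hRL.left, hRL.biorth, hRL'.right, hRL'.left, hRL'.biorth]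
        with ω hi h1 h2 h3 h1' h2' h3' t
      exact Overlap.exists_scale_of_biorthogonal (hi t) (h1 t) (h2 t) (h3 t) (h1' t) (h2' t) (h3' t)
    have ho : ∀ᵐ ω ∂μ, ∀ t,
        Overlap.overlap (R' t ω) (L' t ω) = Overlap.overlap (R t ω) (L t ω) := by
      filter_upwards [hscale] with ω hω t
      obtain ⟨c, hc, hR, hL⟩ := hω t
      rw [hR, hL, Overlap.overlap_scale _ _ hc]
    have hm : ∀ᵐ ω ∂μ, ∀ t, Overlap.martIncr (Λ t ω) (R t ω) (L t ω) =
        Overlap.martIncr (Λ t ω) (R' t ω) (L' t ω) := by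
      filter_upwards [hscale] with ω hω t
      obtain ⟨c, hc, hR, hL⟩ := hω t
      rw [hR, hL, Overlap.martIncr_scale _ _ hc]
    refine ⟨ho, fun X X' hX hX' => hX.ae_forall_eq hX' hΛ.cont hinj ?_ hm⟩
    filter_upwards [ho] with ω hω using (hω 0).symm
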